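/- Let $f_0,f_1$ be smooth ($C^\infty$) vector fields on $\mathbb{R}^d$ with $f_0(0)=f_1(0)=0$, both asymptotically stable at the origin, and let $V:\mathbb{R}^d\to[0,\infty)$ be a smooth common weak Lyapunov function, i.e. $V(0)=0$, $V(x)>0$ for $x\neq 0$, and $L_{f_i}V(x)=dV(x)\cdot f_i(x)\le 0$ for all $x\in\mathbb{R}^d$ and $i=0,1$. Put $\mathcal{K}_i=\{x : L_{f_i}V(x)=0\}$ and $\mathcal{K}=\mathcal{K}_0\cap\mathcal{K}_1$. An input is a piecewise constant, right-continuous function $u:[0,\infty)\to\{0,1\}$ whose switching times have no finite accumulation point. For an input $u$ and $x\in\mathbb{R}^d$ let $\Phi_u(\cdot,x)$ be the solution of $\dot x=f_{u(t)}(x)$ starting at $x$ (and $\Phi_i(\cdot,x)$ the one for the constant input $i$). When it is defined on $[0,\infty)$, let $\Omega_u(x)$ be the set of all limits of sequences $\Phi_u(t_k,x)$ with $t_k\ge 0$ increasing to $+\infty$. Call a closed connected neighbourhood $\mathcal{W}$ of the origin admissible if for all $x\in\mathcal{W}$: for every input $u$ the solution $\Phi_u(t,x)$ is defined for all $t\ge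 0$, is bounded and stays in $\mathcal{W}$; and $\Phi_i(t,x)\to 0$ as $t\to+\infty$ for $i=0,1$. Then: 1. an admissible neighbourhood $\mathcal{W}$ exists; 2. for every admissible neighbourhood $\mathcal{W}$, all $x\in\mathcal{W}$ and all inputs $u$, one has $\Omega_u(x)\cap\mathcal{K}\neq\emptyset$; if moreover $f_0$, $f_1$ and $V$ are (real) analytic, then $\Omega_u(x)\subseteq\mathcal{K}$; 3. if $f_0$ and $f_1$ are globally asymptotically stable at the origin and $V$ is radially unbounded ($V(x)\to+\infty$ as $\|x\|\to\infty$), then $\mathcal{W}=\mathbb{R}^d$ is admissible, so that the conclusions of 2 hold for all $x\in\mathbb{R}^d$ and all inputs $u$. -/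

import Mathlib

open Set Filter Topology
open scoped ContDiff

/-- The state space `ℝ^d` with its Euclidean norm. -/
abbrev StateSpace (d : ℕ) : Type := EuclideanSpace ℝ (Fin d)

/-- Inputs (switching signals): piecewise constant, right-continuous functions of the time
`t ≥ 0`, with switching times `0 = a 0 < a 1 < ...` increasing to `+∞`.
The values of `u` at negative times are irrelevant. -/
def IsInput {ι : Type*} (u : ℝ → ι) : Prop :=
  ∃ a : ℕ → ℝ, a 0 = 0 ∧ StrictMono a ∧ Tendsto a atTop atTop ∧
    ∀ n : ℕ, ∀ t ∈ Ico (a n) (a (n + 1)), u t = u (a n)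

/-- `φ` is a solution, defined on all of `[0, +∞)`, of `φ' = F(t, φ)` with `φ(0) = x`:
`φ` is continuous and its right derivative at every `t ≥ 0` is `F(t, φ(t))`. For
`F(t, ·) = f (u t)` with `u` an input and `f` continuous this says that `φ` is continuous and a
classical solution of `φ' = f_i(φ)` on every interval on which `u` is constant, equal to `i`. -/
def IsForwardSolution {d : ℕ} (F : ℝ → StateSpace d → StateSpace d) (x : StateSpace d)
    (φ : ℝ → StateSpace d) : Prop :=
  φ 0 = x ∧ ContinuousOn φ (Ici 0) ∧
    ∀ t : ℝ, 0 ≤ t → HasDerivWithinAt φ (F t (φ t)) (Ici t) t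

/-- The solution of `x' = g(x)` starting at `x` exists for all `t ≥ 0` and converges to `0`. -/
def FlowConvergesToZero {d : ℕ} (g : StateSpace d → StateSpace d) (x : StateSpace d) : Prop :=
  ∃ φ : ℝ → StateSpace d, IsForwardSolution (fun _ => g) x φ ∧ Tendsto φ atTop (𝓝 0)

/-- (Lyapunov) stability of the vector field `g` at the origin. -/
def IsStableAtZero {d : ℕ} (g : StateSpace d → StateSpace d) : Prop :=
  ∀ δ : ℝ, 0 < δ → ∃ ε : ℝ, 0 < ε ∧ ∀ x : StateSpace d, ‖x‖ ≤ ε →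
    ∃ φ : ℝ → StateSpace d, IsForwardSolution (fun _ => g) x φ ∧ ∀ t : ℝ, 0 ≤ t → ‖φ t‖ ≤ δ

/-- Asymptotic stability at the origin: stability and local attractivity. -/
def IsAsymptoticallyStable {d : ℕ} (g : StateSpace d → StateSpace d) : Prop :=
  IsStableAtZero g ∧
    ∃ δ : ℝ, 0 < δ ∧ ∀ x : StateSpace d, ‖x‖ ≤ δ → FlowConvergesToZero g x

/-- Global asymptotic stability (GAS) at the origin: stability and global attractivity. -/
def IsGloballyAsymptoticallyStable {d : ℕ} (g : StateSpace d → StateSpace d) : Prop :=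
  IsStableAtZero g ∧ ∀ x : StateSpace d, FlowConvergesToZero g x

/-- The Lie derivative `L_g V (x) = dV(x)(g(x))`. -/
noncomputable def lieDerivative {d : ℕ} (g : StateSpace d → StateSpace d)
    (V : StateSpace d → ℝ) (x : StateSpace d) : ℝ :=
  fderiv ℝ V x (g x)

/-- `V` is a smooth weak common Lyapunov function of the vector fields `f i`. -/
structure IsWeakLyapunov {d : ℕ} {ι : Type*} (f : ι → StateSpace d → StateSpace d)
    (V : StateSpace d → ℝ) : Prop where
  smooth : ContDiff ℝ ∞ V
  map_zero : V 0 = 0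
  pos : ∀ x : StateSpace d, x ≠ 0 → 0 < V x
  lie_nonpos : ∀ (i : ι) (x : StateSpace d), lieDerivative (f i) V x ≤ 0

/-- The set of limits of sequences `φ(t_k)` with `0 ≤ t_k` increasing to `+∞`. -/
def omegaLimitSet {d : ℕ} (φ : ℝ → StateSpace d) : Set (StateSpace d) :=
  {l | ∃ t : ℕ → ℝ, StrictMono t ∧ (∀ k, 0 ≤ t k) ∧ Tendsto t atTop atTop ∧
    Tendsto (fun k => φ (t k)) atTop (𝓝 l)}

/-- The set `K_i = {x | L_{f_i} V (x) = 0}` of a vector field `g = f_i`. -/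
def tangencySet {d : ℕ} (g : StateSpace d → StateSpace d) (V : StateSpace d → ℝ) :
    Set (StateSpace d) :=
  {x | lieDerivative g V x = 0}

/-- The neighbourhoods `W` of the origin under consideration: closed connected neighbourhoods
such that every solution of the switched system that starts in `W` is defined for all `t ≥ 0`,
bounded and stays in `W`, and the solution of each single field that starts in `W` converges
to `0`. -/
structure IsAdmissibleNhd {d : ℕ} {ι : Type*} (f : ι → StateSpace d → StateSpace d)
    (W : Set (StateSpace d)) : Prop where
  mem_nhds : W ∈ 𝓝 (0 : StateSpace d)
  isClosed : IsClosed W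
  isConnected : IsConnected W
  forward : ∀ x ∈ W, ∀ u : ℝ → ι, IsInput u →
    ∃ φ : ℝ → StateSpace d, IsForwardSolution (fun t => f (u t)) x φ ∧
      Bornology.IsBounded (φ '' Ici 0) ∧ ∀ t : ℝ, 0 ≤ t → φ t ∈ W
  attracted : ∀ x ∈ W, ∀ i : ι, FlowConvergesToZero (f i) x

/-! Along a bounded trajectory `V` decreases to a limit `c`, so `V = c` on the omega-limit set Ω. If
`c = 0`, then Ω = {0} lies in 𝒦. The core is a comparison (`IsForwardSolution.norm_sub_le`,
`IsForwardSolution.apply_eq_of_tendsto`). Suppose `L_{f_j}V` stays below a negative constant along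
the trajectory on the windows [t_k, t_k + τ], where φ(t_k) → l. Time spent in mode j costs `V` at a
definite rate, but the drop of `V` on these windows tends to 0. Hence mode j is active for a
vanishing time, the trajectory follows the flow Φ_i of the other field from l, and `V = c` along
Φ_i(·, l) on [0, τ].

Analytic case: if `L_{f_j}V(l) < 0`, this holds for some short τ. As `V` ∘ Φ_i(·, l) is analytic, it
equals c for all positive times, and Φ_i(t, l) → 0 gives c = 0. Analyticity of solutions comes from
the inverse function theorem in a Banach space of curves.

Smooth case: at each point of Ω one of the two Lie derivatives vanishes. If Ω misses 𝒦, they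
therefore differ on Ω, hence eventually along the trajectory, and their difference keeps one sign.
So one of them is negative on all of the compact set Ω, the comparison holds for every τ, and again
c = 0.

Admissible neighbourhoods come from sublevel sets of `V`, which no trajectory leaves, whatever the
input. -/

/-! ### Analyticity of superposition operators -/

section Nemytskii

variable {X : Type*} [TopologicalSpace X] [CompactSpace X]
  {E : Type*} [NormedAddCommGroup E] [NormedSpace ℝ E]
  {F : Type*} [NormedAddCommGroup F] [NormedSpace ℝ F]

/-- A continuous multilinear map acts pointwise on continuous functions on a compact space. -/
noncomputable def ContinuousMultilinearMap.pointwise {n : ℕ}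
    (m : ContinuousMultilinearMap ℝ (fun _ : Fin n => E) F) :
    ContinuousMultilinearMap ℝ (fun _ : Fin n => C(X, E)) C(X, F) :=
  MultilinearMap.mkContinuous
    { toFun := fun y => ⟨fun s => m fun k => y k s, by fun_prop⟩
      map_update_add' := by
        intro _ y k a b
        ext s
        have h : ∀ c : C(X, E), (fun j => (Function.update y k c) j s)
            = Function.update (fun j => y j s) k (c s) := by
          intro c; ext j
          by_cases hj : j = k
          · subst hj; simp
          · simp [hj]
        simp [h]
      map_update_smul' := by
        intro _ y k a b
        ext s
        have h : ∀ c : C(X, E), (fun j => (Function.update y k c) j s)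
            = Function.update (fun j => y j s) k (c s) := by
          intro c; ext j
          by_cases hj : j = k
          · subst hj; simp
          · simp [hj]
        simp [h] }
    ‖m‖ (by
      intro y
      rw [ContinuousMap.norm_le _ (by positivity)]
      intro s
      refine (m.le_opNorm _).trans ?_
      gcongr with k
      exact (y k).norm_coe_le_norm s)

theorem ContinuousMultilinearMap.norm_pointwise_le {n : ℕ}
    (m : ContinuousMultilinearMap ℝ (fun _ : Fin n => E) F) :
    ‖(m.pointwise : ContinuousMultilinearMap ℝ (fun _ : Fin n => C(X, E)) C(X, F))‖ ≤ ‖m‖ :=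
  MultilinearMap.mkContinuous_norm_le _ (norm_nonneg _) _

/-- The superposition operator of a map that is analytic at `p` is analytic at the constant
function `p`. -/
theorem AnalyticAt.comp_continuousMap [CompleteSpace F] {g : C(E, F)} {p : E}
    (hg : AnalyticAt ℝ g p) :
    AnalyticAt ℝ (fun y : C(X, E) => g.comp y) (ContinuousMap.const X p) := by
  obtain ⟨q, r, hq⟩ := hg
  -- The power series of `g` at `p` acts pointwise; norms do not grow, so its radius does not
  -- shrink.
  refine ⟨fun n => (q n).pointwise, r, ?_, hq.r_pos, ?_⟩
  · exact hq.r_le.trans (FormalMultilinearSeries.radius_le_of_le fun n =>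
      ContinuousMultilinearMap.norm_pointwise_le _)
  · intro y hy
    have hyr : (‖y‖₊ : ENNReal) < r := by simpa [enorm] using hy
    have hsum : Summable fun n => (q n).pointwise fun _ => y := by
      refine Summable.of_norm_bounded (q.summable_norm_mul_pow (hyr.trans_le hq.r_le)) ?_
      intro n
      refine (ContinuousMultilinearMap.le_opNorm _ _).trans ?_
      rw [Finset.prod_const, Finset.card_univ, Fintype.card_fin]
      gcongr
      · exact ContinuousMultilinearMap.norm_pointwise_le _
      · rfl
    convert! hsum.hasSum
    ext s
    have h1 := (hsum.hasSum.map (ContinuousMap.evalCLM ℝ s : C(X, F) →L[ℝ] F)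
      (ContinuousMap.evalCLM ℝ s).continuous)
    have hys : y s ∈ Metric.eball (0 : E) r := by
      have : ‖y s‖₊ ≤ ‖y‖₊ := y.norm_coe_le_norm s
      have := (ENNReal.coe_le_coe.2 this).trans_lt hyr
      simpa [enorm] using this
    exact (hq.hasSum hys).unique h1

end Nemytskii

/-! ### Integration as a bounded operator on curves -/

section Primitive

variable {E : Type*} [NormedAddCommGroup E] [NormedSpace ℝ E]

/-- The operator that maps `y` to `s ↦ ∫₀ˢ y` on the unit interval. -/
noncomputable def unitIntervalPrimitive : C(unitInterval, E) →L[ℝ] C(unitInterval, E) :=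
  LinearMap.mkContinuous
    { toFun := fun y => ⟨fun s => ∫ t in (0 : ℝ)..s, IccExtend zero_le_one y t, by
        have h : Continuous (IccExtend (zero_le_one (α := ℝ)) y) := y.continuous.Icc_extend'
        exact (intervalIntegral.continuous_primitive (fun a b => h.intervalIntegrable a b) 0).comp
          continuous_subtype_val⟩
      map_add' := by
        intro y z
        ext s
        have h : ∀ y : C(unitInterval, E), Continuous (IccExtend (zero_le_one (α := ℝ)) y) :=
          fun y => y.continuous.Icc_extend'
        exact intervalIntegral.integral_add ((h y).intervalIntegrable _ _)
          ((h z).intervalIntegrable _ _)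
      map_smul' := by
        intro c y
        ext s
        exact intervalIntegral.integral_smul c _ }
    1 (by
      intro y
      rw [ContinuousMap.norm_le _ (by positivity)]
      intro s
      refine (intervalIntegral.norm_integral_le_of_norm_le_const
        (C := ‖y‖) fun t _ => y.norm_coe_le_norm _).trans ?_
      have h0 := s.2.1
      have h1 := s.2.2
      rw [sub_zero, abs_of_nonneg h0, one_mul]
      exact mul_le_of_le_one_right (norm_nonneg _) h1)

theorem unitIntervalPrimitive_apply (y : C(unitInterval, E)) (s : unitInterval) :
    unitIntervalPrimitive y s = ∫ t in (0 : ℝ)..s, IccExtend zero_le_one y t := rfl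

end Primitive

/-! ### Analyticity of solutions of analytic equations -/

section AnalyticODE

variable {E : Type*} [NormedAddCommGroup E] [NormedSpace ℝ E] [CompleteSpace E]

/-- The local solutions of `y = q + ε ∫ g(y)` depend analytically on `ε`. -/
theorem exists_analyticAt_solution_operator {g : C(E, E)} {p : E} (hg : AnalyticAt ℝ g p) :
    ∃ S : ℝ × C(unitInterval, E) → ℝ × C(unitInterval, E),
      AnalyticAt ℝ S (0, ContinuousMap.const _ p) ∧
      ∀ᶠ z in 𝓝 ((0 : ℝ), ContinuousMap.const unitInterval p),
        S (z.1, z.2 - z.1 • unitIntervalPrimitive (g.comp z.2)) = z := by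
  set c := ContinuousMap.const unitInterval p
  set A : C(unitInterval, E) → C(unitInterval, E) := fun y => unitIntervalPrimitive (g.comp y)
    with hA_def
  have hA : AnalyticAt ℝ A c :=
    AnalyticAt.fun_comp (g := unitIntervalPrimitive (E := E)) (ContinuousLinearMap.analyticAt _ _)
      (hg.comp_continuousMap (X := unitInterval))
  set G : ℝ × C(unitInterval, E) → ℝ × C(unitInterval, E) := fun z => (z.1, z.2 - z.1 • A z.2)
    with hG_def
  have hA2 : AnalyticAt ℝ (fun z : ℝ × C(unitInterval, E) => A z.2) (0, c) :=
    AnalyticAt.fun_comp (x := ((0 : ℝ), c)) (f := Prod.snd) hA analyticAt_snd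
  have hG : AnalyticAt ℝ G (0, c) :=
    analyticAt_fst.prod (analyticAt_snd.sub (analyticAt_fst.smul hA2))
  -- At ε = 0 the derivative of `G` is (ε, y) ↦ (ε, y - ε A c), a shear, inverted by changing the
  -- sign.
  let G' : (ℝ × C(unitInterval, E)) ≃L[ℝ] (ℝ × C(unitInterval, E)) :=
    ContinuousLinearEquiv.equivOfInverse
      ((ContinuousLinearMap.fst ℝ _ _).prod (ContinuousLinearMap.snd ℝ _ _ -
        (ContinuousLinearMap.fst ℝ _ _).smulRight (A c)))
      ((ContinuousLinearMap.fst ℝ _ _).prod (ContinuousLinearMap.snd ℝ _ _ +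
        (ContinuousLinearMap.fst ℝ _ _).smulRight (A c)))
      (fun z => by ext <;> simp) (fun z => by ext <;> simp)
  have hG' : HasFDerivAt G (G' : (ℝ × C(unitInterval, E)) →L[ℝ] _) (0, c) := by
    have h1 := (hasFDerivAt_fst (𝕜 := ℝ) (p := ((0 : ℝ), c)))
    have h2 := (hasFDerivAt_snd (𝕜 := ℝ) (p := ((0 : ℝ), c)))
    have h3 := h1.prodMk (h2.sub (h1.smul hA2.differentiableAt.hasFDerivAt))
    refine h3.congr_fderiv ?_
    ext z <;> simp [G']
  have hGω : ContDiffAt ℝ ω G (0, c) := hG.contDiffAt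
  have hG0 : G (0, c) = (0, c) := by simp [hG_def]
  refine ⟨hGω.localInverse hG' (by simp), ?_, ?_⟩
  · have := hGω.to_localInverse hG' (by simp)
    rw [hG0] at this
    exact this.analyticAt
  · exact (hGω.hasStrictFDerivAt' hG' (by simp)).eventually_left_inverse

/-- A curve that solves the integral form of an analytic autonomous differential equation near
a time is analytic at that time. -/
theorem analyticAt_of_integral_eq {g : E → E} (hgc : Continuous g) {γ : ℝ → E} {t₀ : ℝ}
    (hg : AnalyticAt ℝ g (γ t₀)) {r : ℝ} (hr : 0 < r)
    (hγc : ContinuousOn γ (Icc (t₀ - r) (t₀ + r)))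
    (hγ : ∀ t ∈ Icc (t₀ - r) (t₀ + r), γ t = γ t₀ + ∫ s in t₀..t, g (γ s)) :
    AnalyticAt ℝ γ t₀ := by
  obtain ⟨S, hS, hSe⟩ := exists_analyticAt_solution_operator (g := ⟨g, hgc⟩) hg
  set c := ContinuousMap.const unitInterval (γ t₀)
  have hrr : t₀ - r ≤ t₀ + r := by linarith
  set δ : ℝ → E := IccExtend hrr (fun t => γ t) with hδ_def
  have hδc : Continuous δ := (continuousOn_iff_continuous_domRestrict.1 hγc).Icc_extend'
  have hδ : ∀ t ∈ Icc (t₀ - r) (t₀ + r), δ t = γ t := fun t ht => IccExtend_of_mem hrr _ ht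
  -- Rescaling time turns a solution on a short interval of length e into a curve on [0, 1] with e
  -- as a parameter; evaluation at s = 1 recovers γ(t₀ + e).
  let Y : C(ℝ, C(unitInterval, E)) :=
    ContinuousMap.curry ⟨fun z : ℝ × unitInterval => δ (t₀ + z.1 * z.2), by fun_prop⟩
  have hY : ∀ e s, Y e s = δ (t₀ + e * s) := fun e s => rfl
  have hmem : t₀ ∈ Icc (t₀ - r) (t₀ + r) := ⟨by linarith, by linarith⟩
  have hY0 : Y 0 = c := by ext s; simp [hY, hδ t₀ hmem, c]
  have hYt : Tendsto (fun e : ℝ => (e, Y e)) (𝓝 0) (𝓝 (0, c)) := by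
    have : Continuous fun e : ℝ => (e, Y e) := by fun_prop
    simpa [hY0] using this.tendsto 0
  have hev : ∀ᶠ e : ℝ in 𝓝 0, (S (e, c)).2 1 = γ (t₀ + e) := by
    filter_upwards [hYt.eventually hSe, Metric.closedBall_mem_nhds (0 : ℝ) hr] with e he her
    have her' : |e| ≤ r := by simpa using her
    have hin : ∀ s ∈ Icc (0 : ℝ) 1, t₀ + e * s ∈ Icc (t₀ - r) (t₀ + r) := by
      intro s hs
      have : |e * s| ≤ r := by
        rw [abs_mul, abs_of_nonneg hs.1]
        nlinarith [abs_nonneg e, hs.1, hs.2]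
      rw [abs_le] at this
      constructor <;> linarith
    have hfix : Y e - e • unitIntervalPrimitive ((⟨g, hgc⟩ : C(E, E)).comp (Y e)) = c := by
      ext s
      have h1 : unitIntervalPrimitive ((⟨g, hgc⟩ : C(E, E)).comp (Y e)) s
          = ∫ t in (0 : ℝ)..s, g (γ (e * t + t₀)) := by
        rw [unitIntervalPrimitive_apply]
        refine intervalIntegral.integral_congr fun t ht => ?_
        rw [uIcc_of_le s.2.1] at ht
        have ht' : t ∈ Icc (0 : ℝ) 1 := ⟨ht.1, ht.2.trans s.2.2⟩
        have := hδ _ (hin t ht')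
        simp only [IccExtend_of_mem zero_le_one _ ht']
        change g (δ (t₀ + e * t)) = _
        rw [this, add_comm]
      have h2 := intervalIntegral.smul_integral_comp_mul_add (a := 0) (b := (s : ℝ))
        (fun t => g (γ t)) e t₀
      simp only [ContinuousMap.sub_apply, ContinuousMap.smul_apply, h1, h2, hY,
        hδ _ (hin s s.2)]
      rw [hγ _ (hin s s.2)]
      simp [c, add_comm]
    rw [hfix] at he
    have : S (e, c) = (e, Y e) := he
    rw [this]
    change δ (t₀ + e * 1) = _
    rw [mul_one, hδ _ (by simpa using hin 1 (by simp))]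
  have hSa : AnalyticAt ℝ (fun e : ℝ => (S (e, c)).2 1) 0 := by
    have h1 : AnalyticAt ℝ (fun e : ℝ => S (e, c)) 0 :=
      AnalyticAt.fun_comp (f := fun e : ℝ => (e, c)) hS (analyticAt_id.prod analyticAt_const)
    have h2 : AnalyticAt ℝ (fun e : ℝ => (S (e, c)).2) 0 :=
      AnalyticAt.fun_comp (f := fun e : ℝ => S (e, c)) (g := Prod.snd) analyticAt_snd h1
    exact AnalyticAt.fun_comp (g := (ContinuousMap.evalCLM ℝ 1 : C(unitInterval, E) →L[ℝ] E))
      (f := fun e : ℝ => (S (e, c)).2) (ContinuousLinearMap.analyticAt _ _) h2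
  have h3 : AnalyticAt ℝ (fun e => γ (t₀ + e)) 0 := hSa.congr hev
  have h4 : AnalyticAt ℝ (fun t : ℝ => t - t₀) t₀ := analyticAt_id.sub analyticAt_const
  have h5 := AnalyticAt.fun_comp (f := fun t : ℝ => t - t₀) (x := t₀)
    (g := fun e => γ (t₀ + e)) (by simpa using h3) h4
  simpa using h5

end AnalyticODE

/-! ### Existence of trajectories and of admissible neighbourhoods -/

section Existence

variable {d : ℕ}

theorem exists_solution_Icc_of_hasCompactSupport {g : StateSpace d → StateSpace d}
    (hg : ContDiff ℝ 1 g) (hc : HasCompactSupport g) (x : StateSpace d) {a b : ℝ} (hab : a ≤ b) :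
    ∃ γ : ℝ → StateSpace d, γ a = x ∧
      ∀ t ∈ Icc a b, HasDerivWithinAt γ (g (γ t)) (Icc a b) t := by
  obtain ⟨K, hK⟩ := hg.lipschitzWith_of_hasCompactSupport hc (by simp)
  obtain ⟨L, hL⟩ := hg.continuous.bounded_above_of_compact_support hc
  -- The field is globally Lipschitz and bounded by `L`, so the ball of radius `L (b - a)` suffices
  -- for the whole interval.
  have hpl : IsPicardLindelof (fun _ => g) (⟨a, left_mem_Icc.2 hab⟩ : Icc a b) x
      (L.toNNReal * (b - a).toNNReal) 0 L.toNNReal K :=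
    { lipschitzOnWith := fun t _ => hK.lipschitzOnWith
      continuousOn := fun _ _ => continuousOn_const
      norm_le := fun t _ y _ => (hL y).trans (Real.le_coe_toNNReal L)
      mul_max_le := by
        simp [Real.coe_toNNReal _ (sub_nonneg.2 hab), hab] }
  exact hpl.exists_eq_forall_mem_Icc_hasDerivWithinAt₀

theorem exists_mem_Ico_of_tendsto_atTop {a : ℕ → ℝ} (ha : Tendsto a atTop atTop) {t : ℝ}
    (ht : a 0 ≤ t) : ∃ n, t ∈ Ico (a n) (a (n + 1)) := by
  classical
  have h : ∃ n, t < a n := (ha.eventually_gt_atTop t).exists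
  obtain ⟨m, hm⟩ : ∃ m, Nat.find h = m + 1 := by
    refine Nat.exists_eq_succ_of_ne_zero fun h0 => ?_
    have := Nat.find_spec h
    rw [h0] at this
    linarith
  exact ⟨m, not_lt.1 (Nat.find_min h (by omega)), hm ▸ Nat.find_spec h⟩

theorem exists_mem_Ioc_of_tendsto_atTop {a : ℕ → ℝ} (ha : Tendsto a atTop atTop) {t : ℝ}
    (ht : a 0 < t) : ∃ n, t ∈ Ioc (a n) (a (n + 1)) := by
  classical
  have h : ∃ n, t ≤ a n := (ha.eventually_ge_atTop t).exists
  obtain ⟨m, hm⟩ : ∃ m, Nat.find h = m + 1 := by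
    refine Nat.exists_eq_succ_of_ne_zero fun h0 => ?_
    have := Nat.find_spec h
    rw [h0] at this
    linarith
  exact ⟨m, not_le.1 (Nat.find_min h (by omega)), hm ▸ Nat.find_spec h⟩

theorem exists_isForwardSolution_of_hasCompactSupport {ι : Type*}
    {g : ι → StateSpace d → StateSpace d} (hg : ∀ i, ContDiff ℝ 1 (g i))
    (hc : ∀ i, HasCompactSupport (g i)) {u : ℝ → ι} (hu : IsInput u) (x : StateSpace d) :
    ∃ φ, IsForwardSolution (fun t => g (u t)) x φ := by
  classical
  obtain ⟨a, ha0, ham, hat, hua⟩ := hu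
  have hlt : ∀ n, a n < a (n + 1) := fun n => ham n.lt_succ_self
  have hex : ∀ (n : ℕ) (y : StateSpace d), ∃ γ : ℝ → StateSpace d, γ (a n) = y ∧
      ∀ t ∈ Icc (a n) (a (n + 1)),
        HasDerivWithinAt γ (g (u (a n)) (γ t)) (Icc (a n) (a (n + 1))) t := fun n y =>
    exists_solution_Icc_of_hasCompactSupport (hg _) (hc _) y (hlt n).le
  choose γ hγ0 hγ using hex
  let z : ℕ → StateSpace d := fun n => Nat.rec x (fun n y => γ n y (a (n + 1))) n
  have hz : ∀ n, z (n + 1) = γ n (z n) (a (n + 1)) := fun n => rfl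
  let φ : ℝ → StateSpace d := fun t =>
    if h : ∃ n, t ∈ Ico (a n) (a (n + 1)) then γ h.choose (z h.choose) t else x
  have hφ : ∀ n, ∀ t ∈ Ico (a n) (a (n + 1)), φ t = γ n (z n) t := by
    intro n t ht
    have h : ∃ n, t ∈ Ico (a n) (a (n + 1)) := ⟨n, ht⟩
    have hn : h.choose = n := by
      have h1 := h.choose_spec
      have h2 := ham.lt_iff_lt.1 (h1.1.trans_lt ht.2)
      have h3 := ham.lt_iff_lt.1 (ht.1.trans_lt h1.2)
      omega
    simp only [φ, dif_pos h, hn]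
  -- Agreement at the right endpoint as well gives left continuity at the switching times.
  have hφ' : ∀ n, ∀ t ∈ Icc (a n) (a (n + 1)), φ t = γ n (z n) t := by
    intro n t ht
    rcases ht.2.lt_or_eq with h | h
    · exact hφ n t ⟨ht.1, h⟩
    · subst h
      rw [hφ (n + 1) _ ⟨le_rfl, hlt _⟩, hγ0, hz]
  have hder : ∀ t : ℝ, 0 ≤ t → HasDerivWithinAt φ (g (u t) (φ t)) (Ici t) t := by
    intro t ht
    obtain ⟨n, hn⟩ := exists_mem_Ico_of_tendsto_atTop hat (ha0.symm ▸ ht)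
    have hn' := Ico_subset_Icc_self hn
    rw [hua n t hn, hφ n t hn]
    have h1 : HasDerivWithinAt φ (g (u (a n)) (γ n (z n) t)) (Icc (a n) (a (n + 1))) t :=
      (hγ n (z n) t hn').congr (hφ' n) (hφ' n t hn')
    exact h1.mono_of_mem_nhdsWithin
      (mem_of_superset (Icc_mem_nhdsGE hn.2) (Icc_subset_Icc_left hn.1))
  refine ⟨φ, ?_, ?_, hder⟩
  · rw [hφ 0 0 ⟨ha0.le, ha0 ▸ hlt 0⟩]
    have h := hγ0 0 (z 0)
    rw [ha0] at h
    exact h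
  · intro t ht
    rcases (mem_Ici.1 ht).eq_or_lt with rfl | ht
    · exact (hder 0 le_rfl).continuousWithinAt
    · refine ContinuousAt.continuousWithinAt ?_
      refine continuousAt_iff_continuous_left_right.2 ⟨?_, (hder t ht.le).continuousWithinAt⟩
      obtain ⟨n, hn⟩ := exists_mem_Ioc_of_tendsto_atTop hat (ha0.symm ▸ ht)
      have hn' := Ioc_subset_Icc_self hn
      have h1 : ContinuousWithinAt φ (Icc (a n) (a (n + 1))) t :=
        (hγ n (z n) t hn').continuousWithinAt.congr (hφ' n) (hφ' n t hn')
      exact h1.mono_of_mem_nhdsWithin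
        (mem_of_superset (Icc_mem_nhdsLE hn.1) (Icc_subset_Icc_right hn.2))

theorem IsForwardSolution.hasDerivWithinAt_comp {F : ℝ → StateSpace d → StateSpace d}
    {x : StateSpace d} {φ : ℝ → StateSpace d} (hφ : IsForwardSolution F x φ)
    {V : StateSpace d → ℝ} (hV : Differentiable ℝ V) {t : ℝ} (ht : 0 ≤ t) :
    HasDerivWithinAt (fun s => V (φ s)) (lieDerivative (F t) V (φ t)) (Ici t) t :=
  (hV (φ t)).hasFDerivAt.comp_hasDerivWithinAt t (hφ.2.2 t ht)

/-- A mean value inequality that needs right derivatives only, hence passes over switching times. -/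
theorem IsForwardSolution.le_add_of_lieDerivative_le {F : ℝ → StateSpace d → StateSpace d}
    {x : StateSpace d} {φ : ℝ → StateSpace d} (hφ : IsForwardSolution F x φ)
    {V : StateSpace d → ℝ} (hV : Differentiable ℝ V) {C s t : ℝ} (hs : 0 ≤ s) (hst : s ≤ t)
    (hC : ∀ r ∈ Ico s t, lieDerivative (F r) V (φ r) ≤ C) :
    V (φ t) ≤ V (φ s) + C * (t - s) := by
  have hsub : Icc s t ⊆ Ici 0 := fun r hr => hs.trans hr.1
  refine image_le_of_deriv_right_le_deriv_boundary (a := s) (b := t) (f := fun r => V (φ r))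
    (f' := fun r => lieDerivative (F r) V (φ r)) (B := fun r => V (φ s) + C * (r - s))
    (B' := fun _ => C) (hV.continuous.comp_continuousOn (hφ.2.1.mono hsub))
    (fun r hr => hφ.hasDerivWithinAt_comp hV (hs.trans hr.1)) (by simp) (by fun_prop)
    (fun r _ => ?_) hC (right_mem_Icc.2 hst)
  have := (((hasDerivAt_id r).sub_const s).const_mul C).const_add (V (φ s))
  simpa using this.hasDerivWithinAt

theorem IsForwardSolution.antitoneOn {F : ℝ → StateSpace d → StateSpace d}
    {x : StateSpace d} {φ : ℝ → StateSpace d} (hφ : IsForwardSolution F x φ)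
    {V : StateSpace d → ℝ} (hV : Differentiable ℝ V)
    (hF : ∀ t y, lieDerivative (F t) V y ≤ 0) : AntitoneOn (fun t => V (φ t)) (Ici 0) := by
  intro s hs t _ hst
  simpa using hφ.le_add_of_lieDerivative_le hV hs hst fun r _ => hF r _

theorem IsWeakLyapunov.differentiable {ι : Type*} {f : ι → StateSpace d → StateSpace d}
    {V : StateSpace d → ℝ} (hV : IsWeakLyapunov f V) : Differentiable ℝ V :=
  hV.smooth.differentiable (by simp)

/-- A solution of the system cut off outside a ball, which solves the original system as long as it
stays in that ball. -/
theorem exists_antitoneOn_isForwardSolution_of_norm_le {ι : Type*}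
    {f : ι → StateSpace d → StateSpace d} {V : StateSpace d → ℝ}
    (hf : ∀ i, ContDiff ℝ ∞ (f i)) (hV : IsWeakLyapunov f V) {u : ℝ → ι} (hu : IsInput u)
    (x : StateSpace d) {R : ℝ} (hR : 0 < R) :
    ∃ φ : ℝ → StateSpace d, φ 0 = x ∧ ContinuousOn φ (Ici 0) ∧
      AntitoneOn (fun t => V (φ t)) (Ici 0) ∧
      ((∀ t, 0 ≤ t → ‖φ t‖ ≤ R) → IsForwardSolution (fun t => f (u t)) x φ) := by
  -- A nonnegative cutoff keeps the Lie derivatives of `V` nonpositive, so `V` still decreases along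
  -- the modified system.
  let χ : ContDiffBump (0 : StateSpace d) := ⟨R, R + 1, hR, by linarith⟩
  let g : ι → StateSpace d → StateSpace d := fun i y => χ y • f i y
  obtain ⟨φ, hφ⟩ := exists_isForwardSolution_of_hasCompactSupport (g := g)
    (fun i => χ.contDiff.smul ((hf i).of_le (by simp)))
    (fun i => χ.hasCompactSupport.smul_right) hu x
  refine ⟨φ, hφ.1, hφ.2.1, hφ.antitoneOn hV.differentiable fun t y => ?_, fun hb => ?_⟩
  · simp only [lieDerivative, g, map_smul, smul_eq_mul]
    exact mul_nonpos_of_nonneg_of_nonpos χ.nonneg (hV.lie_nonpos _ _)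
  · refine ⟨hφ.1, hφ.2.1, fun t ht => ?_⟩
    have h1 : χ (φ t) = 1 := χ.one_of_mem_closedBall (by simpa using hb t ht)
    simpa [g, h1] using hφ.2.2 t ht

theorem IsClosed.isClosed_connectedComponentIn {X : Type*} [TopologicalSpace X] {S : Set X}
    (hS : IsClosed S) {x : X} (hx : x ∈ S) : IsClosed (connectedComponentIn S x) :=
  isClosed_of_closure_subset <|
    isPreconnected_connectedComponentIn.closure.subset_connectedComponentIn
    (subset_closure (mem_connectedComponentIn hx))
    (hS.closure_subset_iff.2 (connectedComponentIn_subset _ _))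

/-- Inside a ball where both flows are attracted, take a level `m` below all values of `V` on the
bounding sphere. A trajectory that starts in the ball with `V ≤ m` cannot cross the sphere. The
component of 0 is also invariant, as trajectories are connected. -/
theorem exists_isAdmissibleNhd {f : Fin 2 → StateSpace d → StateSpace d} {V : StateSpace d → ℝ}
    (hf : ∀ i, ContDiff ℝ ∞ (f i)) (hV : IsWeakLyapunov f V)
    (hstable : ∀ i, IsAsymptoticallyStable (f i)) : ∃ W, IsAdmissibleNhd f W := by
  choose δ hδ hδc using fun i => (hstable i).2
  obtain ⟨ρ, hρ, hρδ⟩ : ∃ ρ, 0 < ρ ∧ ∀ i, ρ ≤ δ i :=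
    ⟨min (δ 0) (δ 1), lt_min (hδ 0) (hδ 1), by simp [Fin.forall_fin_two]⟩
  have hVc : Continuous V := hV.smooth.continuous
  obtain ⟨m, hm, hmV⟩ : ∃ m, 0 < m ∧ ∀ y : StateSpace d, ‖y‖ = ρ → m < V y := by
    -- The sphere is empty when d = 0.
    rcases (Metric.sphere (0 : StateSpace d) ρ).eq_empty_or_nonempty with h | h
    · refine ⟨1, one_pos, fun y hy => ?_⟩
      have : y ∈ Metric.sphere (0 : StateSpace d) ρ := by simpa using hy
      simp [h] at this
    · obtain ⟨y, hy, hmin⟩ := (isCompact_sphere (0 : StateSpace d) ρ).exists_isMinOn h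
        hVc.continuousOn
      have hy0 : 0 < V y := hV.pos y (by
        rintro rfl
        simp at hy
        linarith)
      refine ⟨V y / 2, by linarith, fun w hw => ?_⟩
      have := hmin (show w ∈ Metric.sphere (0 : StateSpace d) ρ by simpa using hw)
      simp only [mem_ofPred_eq] at this
      linarith
  set S : Set (StateSpace d) := Metric.closedBall 0 ρ ∩ {y | V y ≤ m} with hS
  have hSn : S ∈ 𝓝 (0 : StateSpace d) :=
    inter_mem (Metric.closedBall_mem_nhds _ hρ)
      ((hVc.tendsto' 0 0 hV.map_zero).eventually_le_const hm)
  have h0S : (0 : StateSpace d) ∈ S := mem_of_mem_nhds hSn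
  have hScl : IsClosed S := Metric.isClosed_closedBall.inter (isClosed_le hVc continuous_const)
  refine ⟨connectedComponentIn S 0, ?_, hScl.isClosed_connectedComponentIn h0S,
    isConnected_connectedComponentIn_iff.2 h0S, ?_, ?_⟩
  · obtain ⟨r, hr, hrS⟩ := Metric.mem_nhds_iff.1 hSn
    exact mem_of_superset (Metric.ball_mem_nhds _ hr)
      ((convex_ball _ _).isPreconnected.subset_connectedComponentIn (Metric.mem_ball_self hr) hrS)
  · intro x hx u hu
    have hxS : x ∈ S := connectedComponentIn_subset _ _ hx
    obtain ⟨φ, hφ0, hφc, hφV, hφ⟩ := exists_antitoneOn_isForwardSolution_of_norm_le hf hV hu x hρ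
    have hVm : ∀ t, 0 ≤ t → V (φ t) ≤ m := fun t ht => by
      have := hφV self_mem_Ici ht ht
      simp only [hφ0] at this
      exact this.trans hxS.2
    have hb : ∀ t, 0 ≤ t → ‖φ t‖ ≤ ρ := by
      intro t ht
      by_contra! hlt
      have hx' : ‖φ 0‖ ≤ ρ := by simpa [hφ0] using hxS.1
      obtain ⟨s, hs, hsρ⟩ := intermediate_value_Icc ht
        (hφc.norm.mono fun r hr => hr.1) ⟨hx', hlt.le⟩
      exact (hmV _ hsρ).not_ge (hVm s hs.1)
    refine ⟨φ, hφ hb, ?_, fun t ht => ?_⟩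
    · refine Metric.isBounded_closedBall.subset (t := Metric.closedBall (0 : StateSpace d) ρ) ?_
      rintro _ ⟨t, ht, rfl⟩
      simpa using hb t ht
    · have hpc : IsPreconnected (φ '' Ici 0) := isPreconnected_Ici.image φ hφc
      have hsub : φ '' Ici 0 ⊆ S := by
        rintro _ ⟨t, ht, rfl⟩
        exact ⟨by simpa using hb t ht, hVm t ht⟩
      rw [connectedComponentIn_eq hx]
      exact hpc.subset_connectedComponentIn ⟨0, self_mem_Ici, hφ0⟩ hsub ⟨t, ht, rfl⟩
  · intro x hx i
    have hxS : x ∈ S := connectedComponentIn_subset _ _ hx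
    exact hδc i x ((by simpa using hxS.1 : ‖x‖ ≤ ρ).trans (hρδ i))

theorem isAdmissibleNhd_univ {ι : Type*} {f : ι → StateSpace d → StateSpace d}
    {V : StateSpace d → ℝ} (hf : ∀ i, ContDiff ℝ ∞ (f i)) (hV : IsWeakLyapunov f V)
    (hstable : ∀ i, IsGloballyAsymptoticallyStable (f i))
    (hVt : Tendsto V (cocompact (StateSpace d)) atTop) : IsAdmissibleNhd f univ := by
  refine ⟨univ_mem, isClosed_univ, isConnected_univ, ?_, fun x _ i => (hstable i).2 x⟩
  intro x _ u hu
  obtain ⟨R, hR, hRV⟩ : ∃ R, 0 < R ∧ ∀ y, V y ≤ V x → ‖y‖ ≤ R := by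
    have h := hVt.eventually_gt_atTop (V x)
    rw [← Metric.cobounded_eq_cocompact, ← comap_norm_atTop, eventually_comap] at h
    obtain ⟨R, hR⟩ := (h.and (eventually_gt_atTop 0)).exists_forall_of_atTop
    refine ⟨R, (hR R le_rfl).2, fun y hy => ?_⟩
    by_contra! hlt
    exact ((hR _ hlt.le).1 y rfl).not_ge hy
  obtain ⟨φ, hφ0, hφc, hφV, hφ⟩ := exists_antitoneOn_isForwardSolution_of_norm_le hf hV hu x hR
  have hb : ∀ t, 0 ≤ t → ‖φ t‖ ≤ R := fun t ht => hRV _ (by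
    have := hφV self_mem_Ici ht ht
    simpa only [hφ0] using this)
  refine ⟨φ, hφ hb, ?_, fun t _ => mem_univ _⟩
  refine Metric.isBounded_closedBall.subset (t := Metric.closedBall (0 : StateSpace d) R) ?_
  rintro _ ⟨t, ht, rfl⟩
  simpa using hb t ht

end Existence

/-! ### Uniqueness, comparison of trajectories with single flows, analytic continuation -/

section Solutions

variable {d : ℕ}

theorem IsForwardSolution.shift {F : ℝ → StateSpace d → StateSpace d} {x : StateSpace d}
    {φ : ℝ → StateSpace d} (hφ : IsForwardSolution F x φ) {t : ℝ} (ht : 0 ≤ t) :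
    IsForwardSolution (fun s => F (t + s)) (φ t) (fun s => φ (t + s)) := by
  refine ⟨by simp, ?_, fun s hs => ?_⟩
  · refine hφ.2.1.comp (by fun_prop) fun s hs => ?_
    exact add_nonneg ht hs
  · have h1 : HasDerivWithinAt (fun s => t + s) 1 (Ici s) s :=
      ((hasDerivAt_id s).const_add t).hasDerivWithinAt
    have h2 := (hφ.2.2 (t + s) (add_nonneg ht hs)).scomp s h1
      (fun r hr => by simpa using hr)
    simpa [Function.comp_def] using h2

theorem exists_lipschitzOnWith_closedBall {ι : Type*} [Fintype ι]
    {f : ι → StateSpace d → StateSpace d} (hf : ∀ i, ContDiff ℝ ∞ (f i)) (R : ℝ) :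
    ∃ K : NNReal, ∀ i, LipschitzOnWith K (f i) (Metric.closedBall 0 R) := by
  have h : ∀ i, ∃ K : NNReal, LipschitzOnWith K (f i) (Metric.closedBall 0 R) := fun i =>
    ((hf i).of_le (by simp : (1 : WithTop ℕ∞) ≤ ∞)).locallyLipschitz.locallyLipschitzOn
      |>.exists_lipschitzOnWith_of_compact (isCompact_closedBall _ _)
  choose K hK using h
  exact ⟨Finset.univ.sup K, fun i => (hK i).weaken (Finset.le_sup (Finset.mem_univ i))⟩

theorem exists_norm_le_closedBall {ι : Type*} [Fintype ι]
    {f : ι → StateSpace d → StateSpace d} (hf : ∀ i, Continuous (f i)) (R : ℝ) :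
    ∃ C : ℝ, 0 < C ∧ ∀ i, ∀ y, ‖y‖ ≤ R → ‖f i y‖ ≤ C := by
  have h : ∀ i, ∃ C, ∀ y ∈ Metric.closedBall (0 : StateSpace d) R, ‖f i y‖ ≤ C := fun i =>
    (isCompact_closedBall _ _).exists_bound_of_continuousOn (hf i).continuousOn
  choose C hC using h
  refine ⟨∑ i, |C i| + 1, by positivity, fun i y hy => ?_⟩
  have h1 := hC i y (by simpa using hy)
  have h2 : |C i| ≤ ∑ i, |C i| :=
    Finset.single_le_sum (f := fun i => |C i|) (fun _ _ => abs_nonneg _) (Finset.mem_univ i)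
  linarith [le_abs_self (C i)]

/-- Uniqueness of the solutions of a switched system of smooth fields. -/
theorem IsForwardSolution.eqOn {ι : Type*} [Fintype ι] {f : ι → StateSpace d → StateSpace d}
    (hf : ∀ i, ContDiff ℝ ∞ (f i)) {u : ℝ → ι} {x : StateSpace d} {φ ψ : ℝ → StateSpace d}
    (hφ : IsForwardSolution (fun t => f (u t)) x φ)
    (hψ : IsForwardSolution (fun t => f (u t)) x ψ) : EqOn φ ψ (Ici 0) := by
  intro T hT
  have hsub : Icc 0 T ⊆ Ici 0 := fun r hr => hr.1
  obtain ⟨C, hC⟩ := isCompact_Icc.exists_bound_of_continuousOn (hφ.2.1.mono hsub)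
  obtain ⟨D, hD⟩ := isCompact_Icc.exists_bound_of_continuousOn (hψ.2.1.mono hsub)
  obtain ⟨K, hK⟩ := exists_lipschitzOnWith_closedBall hf (max C D)
  refine ODE_solution_unique_of_mem_Icc_right (v := fun t => f (u t)) (K := K)
    (s := fun _ => Metric.closedBall 0 (max C D)) (fun t _ => hK (u t)) (hφ.2.1.mono hsub)
    (fun t ht => hφ.2.2 t ht.1) (fun t ht => ?_) (hψ.2.1.mono hsub)
    (fun t ht => hψ.2.2 t ht.1) (fun t ht => ?_) (hφ.1.trans hψ.1.symm) ⟨hT, le_rfl⟩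
  · simpa using Or.inl (hC t ⟨ht.1, ht.2.le⟩)
  · simpa using Or.inr (hD t ⟨ht.1, ht.2.le⟩)

theorem FlowConvergesToZero.exists_bounded {g : StateSpace d → StateSpace d} {x : StateSpace d}
    (h : FlowConvergesToZero g x) :
    ∃ γ R, IsForwardSolution (fun _ => g) x γ ∧ Tendsto γ atTop (𝓝 0) ∧
      ∀ t : ℝ, 0 ≤ t → ‖γ t‖ ≤ R := by
  obtain ⟨γ, hγ, hγ0⟩ := h
  obtain ⟨T, hT⟩ := ((hγ0.norm.eventually_le_const
    (show ‖(0 : StateSpace d)‖ < 1 by simp)).and (eventually_ge_atTop 0)).exists_forall_of_atTop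
  obtain ⟨C, hC⟩ := isCompact_Icc.exists_bound_of_continuousOn
    (hγ.2.1.mono (fun r hr => hr.1 : Icc 0 T ⊆ Ici 0))
  refine ⟨γ, max C 1, hγ, hγ0, fun t ht => ?_⟩
  rcases le_total t T with h | h
  · exact (hC t ⟨ht, h⟩).trans (le_max_left _ _)
  · exact (hT t h).1.trans (le_max_right _ _)

/-- The values of the Lyapunov function control the distance between a solution of the switched
system and a solution of one of its fields, if the function strictly decreases along the other. -/
theorem IsForwardSolution.norm_sub_le {ι : Type*} {f : ι → StateSpace d → StateSpace d}
    {V : StateSpace d → ℝ} (hV : IsWeakLyapunov f V) {i j : ι} (hij : ∀ k, k = i ∨ k = j)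
    {u : ℝ → ι} {x l : StateSpace d} {φ γ : ℝ → StateSpace d}
    (hφ : IsForwardSolution (fun t => f (u t)) x φ) (hγ : IsForwardSolution (fun _ => f i) l γ)
    {R M η δ τ : ℝ} {K : NNReal} (hφR : ∀ t, 0 ≤ t → ‖φ t‖ ≤ R) (hγR : ∀ t, 0 ≤ t → ‖γ t‖ ≤ R)
    (hK : LipschitzOnWith K (f i) (Metric.closedBall 0 R))
    (hM : ∀ y, ‖y‖ ≤ R → ‖f j y - f i y‖ ≤ M) (hη : 0 < η) (hδ : 0 < δ) (hτ : 0 ≤ τ)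
    (hj : ∀ s ∈ Icc 0 τ, lieDerivative (f j) V (φ s) ≤ -η) (hxl : ‖x - l‖ ≤ δ) :
    ‖φ τ - γ τ‖ ≤ Real.exp ((K + 1) * τ) * (δ + M / η * (V x - V (φ τ))) := by
  have hM0 : 0 ≤ M := (norm_nonneg _).trans (hM (φ 0) (hφR 0 le_rfl))
  have hVd := hV.differentiable
  have hanti := hφ.antitoneOn hVd fun t y => hV.lie_nonpos (u t) y
  have hsub : Icc 0 τ ⊆ Ici 0 := fun r hr => hr.1
  have hexp : ∀ s : ℝ, HasDerivAt (fun s => Real.exp ((K + 1) * s))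
      (Real.exp ((K + 1) * s) * (K + 1)) s := fun s => by
    simpa using ((hasDerivAt_id s).const_mul ((K : ℝ) + 1)).exp
  -- In mode i the exponential absorbs the Lipschitz growth; in mode j the extra speed, at most `M`,
  -- is paid for by the decrease of `V` at rate at least η. The fencing argument needs a strict
  -- inequality: hence `K + 1` in place of `K`, and δ > 0.
  refine image_norm_le_of_norm_deriv_right_lt_deriv_boundary' (a := 0) (b := τ)
    (f := fun s => φ s - γ s) (f' := fun s => f (u s) (φ s) - f i (γ s))
    (B := fun s => Real.exp ((K + 1) * s) * (δ + M / η * (V x - V (φ s))))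
    (B' := fun s => Real.exp ((K + 1) * s) * (K + 1) * (δ + M / η * (V x - V (φ s))) +
      Real.exp ((K + 1) * s) * (M / η * -lieDerivative (f (u s)) V (φ s)))
    ((hφ.2.1.sub hγ.2.1).mono hsub) (fun s hs => (hφ.2.2 s hs.1).sub (hγ.2.2 s hs.1))
    (by simpa [hφ.1, hγ.1] using hxl) ?_ ?_ ?_ (right_mem_Icc.2 hτ)
  · have h1 : ContinuousOn (fun s => V (φ s)) (Icc 0 τ) :=
      hVd.continuous.comp_continuousOn (hφ.2.1.mono hsub)
    exact (continuousOn_of_forall_continuousAt fun s _ => (hexp s).continuousAt).mul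
      (continuousOn_const.add (continuousOn_const.mul (continuousOn_const.sub h1)))
  · intro s hs
    exact (hexp s).hasDerivWithinAt.mul ((((hφ.hasDerivWithinAt_comp hVd hs.1).const_sub
      (V x)).const_mul (M / η)).const_add δ)
  · intro s hs hB
    have hlie := hV.lie_nonpos (u s) (φ s)
    have hVs : V (φ s) ≤ V x := by simpa [hφ.1] using hanti self_mem_Ici hs.1 hs.1
    have hpos : 0 < Real.exp ((K + 1) * s) * (δ + M / η * (V x - V (φ s))) := by
      have : 0 ≤ M / η * (V x - V (φ s)) := mul_nonneg (by positivity) (by linarith)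
      positivity
    have hLip : ‖f i (φ s) - f i (γ s)‖ ≤ K * ‖φ s - γ s‖ :=
      hK.norm_sub_le (by simpa using hφR s hs.1) (by simpa using hγR s hs.1)
    rw [hB] at hLip
    rcases hij (u s) with h | h <;> rw [h] at hlie ⊢
    · have : 0 ≤ Real.exp ((K + 1) * s) * (M / η * -lieDerivative (f i) V (φ s)) :=
        mul_nonneg (by positivity) (mul_nonneg (by positivity) (by linarith))
      linarith
    · have h1 : M ≤ Real.exp ((K + 1) * s) * (M / η * -lieDerivative (f j) V (φ s)) := by
        have h2 : M ≤ M / η * -lieDerivative (f j) V (φ s) := by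
          rw [div_mul_eq_mul_div, le_div_iff₀ hη]
          exact mul_le_mul_of_nonneg_left (by linarith [hj s ⟨hs.1, hs.2.le⟩]) hM0
        refine h2.trans (le_mul_of_one_le_left (hM0.trans h2) (Real.one_le_exp ?_))
        exact mul_nonneg (by positivity) hs.1
      have h3 : ‖f j (φ s) - f i (γ s)‖ ≤ ‖f j (φ s) - f i (φ s)‖ + ‖f i (φ s) - f i (γ s)‖ :=
        norm_sub_le_norm_sub_add_norm_sub _ _ _
      have h4 := hM (φ s) (hφR s hs.1)
      linarith

/-- If near a limit point `l` the Lyapunov function strictly decreases along `f j`, it is constant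
along the solution of `f i` that starts at `l`. -/
theorem IsForwardSolution.apply_eq_of_tendsto {ι : Type*} [Fintype ι]
    {f : ι → StateSpace d → StateSpace d}
    {V : StateSpace d → ℝ} (hf : ∀ i, ContDiff ℝ ∞ (f i)) (hV : IsWeakLyapunov f V) {i j : ι}
    (hij : ∀ k, k = i ∨ k = j)
    {u : ℝ → ι} {x l : StateSpace d} {φ γ : ℝ → StateSpace d}
    (hφ : IsForwardSolution (fun t => f (u t)) x φ) (hγ : IsForwardSolution (fun _ => f i) l γ)
    {R : ℝ} (hφR : ∀ t, 0 ≤ t → ‖φ t‖ ≤ R) (hγR : ∀ t, 0 ≤ t → ‖γ t‖ ≤ R)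
    {c : ℝ} (hc : Tendsto (fun t => V (φ t)) atTop (𝓝 c))
    {L : Filter ℝ} [L.NeBot] (hL : L ≤ atTop) (hl : Tendsto φ L (𝓝 l))
    {η τ : ℝ} (hη : 0 < η) (hτ : 0 ≤ τ)
    (hj : ∀ᶠ t in L, ∀ s ∈ Icc 0 τ, lieDerivative (f j) V (φ (t + s)) ≤ -η) :
    V (γ τ) = c := by
  obtain ⟨K, hK⟩ := exists_lipschitzOnWith_closedBall hf R
  obtain ⟨C, hC, hCf⟩ := exists_norm_le_closedBall (fun i => (hf i).continuous) R
  have hLτ : Tendsto (fun t => t + τ) L atTop :=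
    (tendsto_atTop_add_const_right _ _ tendsto_id).mono_left hL
  have hVτ := hc.comp hLτ
  have hV0 := hc.mono_left hL
  have hinv : Tendsto (fun t : ℝ => t⁻¹) L (𝓝 0) := tendsto_inv_atTop_zero.mono_left hL
  -- The term `t⁻¹` makes the initial error strictly positive.
  have hδ : Tendsto (fun t => ‖φ t - l‖ + t⁻¹) L (𝓝 0) := by
    have := (tendsto_iff_norm_sub_tendsto_zero.1 hl).add hinv
    simpa using this
  have hbd : Tendsto (fun t => Real.exp ((K + 1) * τ) *
      ((‖φ t - l‖ + t⁻¹) + (C + C) / η * (V (φ t) - V (φ (t + τ))))) L (𝓝 0) := by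
    have := (hδ.add ((hV0.sub hVτ).const_mul ((C + C) / η))).const_mul (Real.exp ((K + 1) * τ))
    simpa using this
  have hlim : Tendsto (fun t => φ (t + τ)) L (𝓝 (γ τ)) := by
    rw [tendsto_iff_norm_sub_tendsto_zero]
    refine squeeze_zero' (Eventually.of_forall fun _ => norm_nonneg _) ?_ hbd
    filter_upwards [hj, hL (eventually_gt_atTop 0)] with t htj ht
    have ht0 : 0 ≤ t := le_of_lt ht
    have ht' : 0 < t⁻¹ := inv_pos.2 ht
    exact (hφ.shift ht0).norm_sub_le hV hij hγ (fun s hs => hφR _ (add_nonneg ht0 hs)) hγR (hK i)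
      (fun y hy => (_root_.norm_sub_le _ _).trans (add_le_add (hCf j y hy) (hCf i y hy))) hη
      (by positivity) hτ htj (by linarith)
  exact tendsto_nhds_unique ((hV.smooth.continuous.tendsto _).comp hlim) hVτ

theorem IsForwardSolution.exists_forall_mem_of_tendsto {ι : Type*} [Fintype ι]
    {f : ι → StateSpace d → StateSpace d} (hf : ∀ i, Continuous (f i))
    {u : ℝ → ι} {x l : StateSpace d} {φ : ℝ → StateSpace d}
    (hφ : IsForwardSolution (fun t => f (u t)) x φ)
    {R : ℝ} (hφR : ∀ t, 0 ≤ t → ‖φ t‖ ≤ R)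
    {L : Filter ℝ} (hL : L ≤ atTop) (hl : Tendsto φ L (𝓝 l)) {O : Set (StateSpace d)}
    (hO : O ∈ 𝓝 l) : ∃ τ, 0 < τ ∧ ∀ᶠ t in L, ∀ s ∈ Icc 0 τ, φ (t + s) ∈ O := by
  obtain ⟨C, hC, hCf⟩ := exists_norm_le_closedBall hf R
  obtain ⟨r, hr, hrO⟩ := Metric.mem_nhds_iff.1 hO
  -- The speed is at most `C`, so in this time the trajectory moves by at most r / 2.
  refine ⟨r / 2 / C, by positivity, ?_⟩
  filter_upwards [hl (Metric.ball_mem_nhds l (half_pos hr)), hL (eventually_ge_atTop 0)]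
    with t ht (ht0 : 0 ≤ t) s hs
  have h1 : ‖φ (t + s) - φ t‖ ≤ C * (t + s - t) := by
    have hsub : Icc t (t + s) ⊆ Ici 0 := fun r hr => ht0.trans hr.1
    refine norm_image_sub_le_of_norm_deriv_right_le_segment (hφ.2.1.mono hsub)
      (fun r hr => hφ.2.2 r (ht0.trans hr.1)) (fun r hr => ?_) (t + s) (by simpa using hs.1)
    exact hCf _ _ (hφR r (ht0.trans hr.1))
  have h2 : C * (t + s - t) ≤ r / 2 := by
    have := hs.2
    rw [le_div_iff₀ hC] at this
    linarith
  have h3 : dist (φ t) l < r / 2 := ht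
  refine hrO (Metric.mem_ball.2 ?_)
  have h4 := dist_triangle (φ (t + s)) (φ t) l
  rw [dist_eq_norm (φ (t + s)) (φ t)] at h4
  linarith

theorem IsForwardSolution.analyticAt {g : StateSpace d → StateSpace d} {x : StateSpace d}
    {γ : ℝ → StateSpace d} (hg : AnalyticOnNhd ℝ g univ)
    (hγ : IsForwardSolution (fun _ => g) x γ) {t : ℝ} (ht : 0 < t) : AnalyticAt ℝ γ t := by
  have hgc : Continuous g := continuousOn_univ.1 hg.continuousOn
  have hsub : Icc (t - t / 2) (t + t / 2) ⊆ Ici 0 := fun r hr => by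
    have := hr.1
    simp only [mem_Ici]
    linarith
  -- The radius t / 2 keeps the two-sided interval inside the nonnegative times.
  refine analyticAt_of_integral_eq hgc (hg _ (mem_univ _)) (half_pos ht) (hγ.2.1.mono hsub) ?_
  intro s hs
  have hsub' : uIcc t s ⊆ Ici 0 := (uIcc_subset_Icc ⟨by linarith, by linarith⟩ hs).trans hsub
  rw [intervalIntegral.integral_eq_sub_of_hasDeriv_right (hγ.2.1.mono hsub')]
  · simp
  · intro r hr
    exact (hγ.2.2 r (hsub' ⟨hr.1.le, hr.2.le⟩)).mono Ioi_subset_Ici_self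
  · exact (hgc.comp_continuousOn (hγ.2.1.mono hsub')).intervalIntegrable

/-- An analytic function that is constant along a nontrivial piece of a solution of an analytic
field is constant along the whole solution. -/
theorem IsForwardSolution.eq_of_tendsto_zero {g : StateSpace d → StateSpace d} {x : StateSpace d}
    {γ : ℝ → StateSpace d} (hg : AnalyticOnNhd ℝ g univ) {V : StateSpace d → ℝ}
    (hV : AnalyticOnNhd ℝ V univ) (hγ : IsForwardSolution (fun _ => g) x γ)
    (hγ0 : Tendsto γ atTop (𝓝 0)) {c τ : ℝ} (hτ : 0 < τ)
    (hc : ∀ s ∈ Icc 0 τ, V (γ s) = c) : c = V 0 := by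
  have h1 : AnalyticOnNhd ℝ (fun t => V (γ t)) (Ioi 0) := fun t ht =>
    AnalyticAt.fun_comp (g := V) (hV _ (mem_univ _)) (hγ.analyticAt hg ht)
  have h2 : EqOn (fun t => V (γ t)) (fun _ => c) (Ioi 0) := by
    refine h1.eqOn_of_preconnected_of_eventuallyEq analyticOnNhd_const isPreconnected_Ioi
      (z₀ := τ / 2) (half_pos hτ) ?_
    filter_upwards [Icc_mem_nhds (half_pos hτ) (half_lt_self hτ)] with s hs using hc s hs
  have h3 : Tendsto (fun t => V (γ t)) atTop (𝓝 (V 0)) :=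
    (hV 0 (mem_univ _)).continuousAt.tendsto.comp hγ0
  refine tendsto_nhds_unique (tendsto_const_nhds.congr' ?_) h3
  filter_upwards [eventually_gt_atTop 0] with t ht using (h2 ht).symm

end Solutions

/-! ### Omega-limit sets of bounded curves -/

section OmegaLimit

variable {d : ℕ}

theorem mem_omegaLimitSet_iff_mapClusterPt {φ : ℝ → StateSpace d} {l : StateSpace d} :
    l ∈ omegaLimitSet φ ↔ MapClusterPt l atTop φ := by
  constructor
  · rintro ⟨t, -, -, ht, hl⟩
    exact MapClusterPt.of_comp ht hl.mapClusterPt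
  · intro h
    obtain ⟨t, hl, ht⟩ := h.exists_seq_tendsto
    obtain ⟨N, hN⟩ := (ht.eventually_ge_atTop 0).exists_forall_of_atTop
    have h1 : Tendsto (fun n => t (n + N)) atTop atTop := ht.comp (tendsto_add_atTop_nat N)
    obtain ⟨ψ, hψ, hψm⟩ := strictMono_subseq_of_tendsto_atTop h1
    exact ⟨_, hψm, fun k => hN _ (Nat.le_add_left _ _), h1.comp hψ.tendsto_atTop,
      (hl.comp (tendsto_add_atTop_nat N)).comp hψ.tendsto_atTop⟩

theorem exists_filter_of_mem_omegaLimitSet {φ : ℝ → StateSpace d} {l : StateSpace d}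
    (h : l ∈ omegaLimitSet φ) : ∃ L : Filter ℝ, L.NeBot ∧ L ≤ atTop ∧ Tendsto φ L (𝓝 l) := by
  obtain ⟨t, -, -, ht, hl⟩ := h
  exact ⟨map t atTop, inferInstance, ht, tendsto_map'_iff.2 hl⟩

theorem exists_mem_omegaLimitSet_of_frequently {φ : ℝ → StateSpace d} {S : Set (StateSpace d)}
    (hS : IsCompact S) (h : ∃ᶠ t in atTop, φ t ∈ S) : ∃ l ∈ S, l ∈ omegaLimitSet φ := by
  simpa only [mem_omegaLimitSet_iff_mapClusterPt] using hS.exists_mapClusterPt_of_frequently h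

theorem eventually_mem_of_omegaLimitSet_subset {φ : ℝ → StateSpace d} {R : ℝ}
    (hφR : ∀ t, 0 ≤ t → ‖φ t‖ ≤ R) {O : Set (StateSpace d)} (hO : IsOpen O)
    (hsub : omegaLimitSet φ ⊆ O) : ∀ᶠ t in atTop, φ t ∈ O := by
  by_contra h
  rw [not_eventually] at h
  obtain ⟨l, hl, hlΩ⟩ := exists_mem_omegaLimitSet_of_frequently (φ := φ)
    ((isCompact_closedBall (0 : StateSpace d) R).inter_right hO.isClosed_compl)
    ((h.and_eventually (eventually_ge_atTop 0)).mono fun t ht =>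
      ⟨by simpa using hφR t ht.2, ht.1⟩)
  exact hl.2 (hsub hlΩ)

theorem isCompact_omegaLimitSet {φ : ℝ → StateSpace d} {R : ℝ}
    (hφR : ∀ t, 0 ≤ t → ‖φ t‖ ≤ R) : IsCompact (omegaLimitSet φ) := by
  have hcl : IsClosed (omegaLimitSet φ) := by
    have : omegaLimitSet φ = {l | ClusterPt l (map φ atTop)} := by
      ext l
      exact mem_omegaLimitSet_iff_mapClusterPt
    rw [this]
    exact isClosed_setOfPred_clusterPt
  refine (isCompact_closedBall (0 : StateSpace d) R).of_isClosed_subset hcl ?_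
  rintro l ⟨t, -, ht0, -, hl⟩
  exact Metric.isClosed_closedBall.mem_of_tendsto hl
    (Eventually.of_forall fun k => by simpa using hφR _ (ht0 k))

theorem omegaLimitSet_nonempty {φ : ℝ → StateSpace d} {R : ℝ}
    (hφR : ∀ t, 0 ≤ t → ‖φ t‖ ≤ R) : (omegaLimitSet φ).Nonempty := by
  obtain ⟨l, -, hl⟩ := exists_mem_omegaLimitSet_of_frequently (φ := φ)
    (isCompact_closedBall (0 : StateSpace d) R)
    (((eventually_ge_atTop 0).mono fun t ht => by simpa using hφR t ht).frequently)
  exact ⟨l, hl⟩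

end OmegaLimit

/-! ### Limit points and tangency to the level sets -/

section Main

variable {d : ℕ}

theorem IsWeakLyapunov.continuous_lieDerivative {ι : Type*} {f : ι → StateSpace d → StateSpace d}
    {V : StateSpace d → ℝ} (hV : IsWeakLyapunov f V) (hf : ∀ i, ContDiff ℝ ∞ (f i)) (i : ι) :
    Continuous (lieDerivative (f i) V) :=
  (hV.smooth.continuous_fderiv (by simp)).clm_apply (hf i).continuous

theorem IsForwardSolution.exists_tendsto {ι : Type*} {f : ι → StateSpace d → StateSpace d}
    {V : StateSpace d → ℝ} (hV : IsWeakLyapunov f V) {u : ℝ → ι} {x : StateSpace d}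
    {φ : ℝ → StateSpace d} (hφ : IsForwardSolution (fun t => f (u t)) x φ) :
    ∃ c, Tendsto (fun t => V (φ t)) atTop (𝓝 c) := by
  have hanti := hφ.antitoneOn hV.differentiable fun t y => hV.lie_nonpos (u t) y
  have hVn : ∀ y, 0 ≤ V y := fun y => by
    rcases eq_or_ne y 0 with rfl | h
    · exact hV.map_zero.ge
    · exact (hV.pos y h).le
  -- Nothing is known at negative times, hence the truncation.
  have h1 : Antitone fun t : ℝ => V (φ (max t 0)) := fun s t hst =>
    hanti (mem_Ici.2 (le_max_right _ _)) (mem_Ici.2 (le_max_right _ _)) (max_le_max_right 0 hst)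
  refine ⟨_, (tendsto_atTop_ciInf h1 ⟨0, ?_⟩).congr' ?_⟩
  · rintro _ ⟨t, rfl⟩
    exact hVn _
  · filter_upwards [eventually_ge_atTop 0] with t ht
    simp [ht]

variable {ι : Type*} [Fintype ι] {f : ι → StateSpace d → StateSpace d} {V : StateSpace d → ℝ}
  {u : ℝ → ι} {x : StateSpace d} {φ : ℝ → StateSpace d} {R c : ℝ} {i j : ι}

/-- Otherwise `V` would drop by a fixed amount, whatever the input, after each of the times at which
the trajectory approaches `l`, and could not converge. -/
theorem IsForwardSolution.lieDerivative_eq_zero_or (hf : ∀ i, ContDiff ℝ ∞ (f i))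
    (hV : IsWeakLyapunov f V) (hij : ∀ k, k = i ∨ k = j)
    (hφ : IsForwardSolution (fun t => f (u t)) x φ) (hφR : ∀ t, 0 ≤ t → ‖φ t‖ ≤ R)
    (hc : Tendsto (fun t => V (φ t)) atTop (𝓝 c)) {l : StateSpace d} (hl : l ∈ omegaLimitSet φ) :
    lieDerivative (f i) V l = 0 ∨ lieDerivative (f j) V l = 0 := by
  by_contra! hne
  have hi : lieDerivative (f i) V l < 0 := (hV.lie_nonpos i l).lt_of_ne hne.1
  have hj : lieDerivative (f j) V l < 0 := (hV.lie_nonpos j l).lt_of_ne hne.2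
  obtain ⟨C, hCm, hC0⟩ := exists_between (max_lt hi hj)
  obtain ⟨L, hLb, hL, hLl⟩ := exists_filter_of_mem_omegaLimitSet hl
  have hO : {y | lieDerivative (f i) V y < C ∧ lieDerivative (f j) V y < C} ∈ 𝓝 l :=
    ((hV.continuous_lieDerivative hf i).continuousAt.eventually_lt_const
      ((le_max_left _ _).trans_lt hCm)).and
    ((hV.continuous_lieDerivative hf j).continuousAt.eventually_lt_const
      ((le_max_right _ _).trans_lt hCm))
  obtain ⟨τ, hτ, hτL⟩ := hφ.exists_forall_mem_of_tendsto (fun k => (hf k).continuous) hφR hL hLl hO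
  have h1 : ∀ᶠ t in L, V (φ (t + τ)) ≤ V (φ t) + C * τ := by
    filter_upwards [hτL, hL (eventually_ge_atTop 0)] with t ht (ht0 : 0 ≤ t)
    have := hφ.le_add_of_lieDerivative_le hV.differentiable (C := C) ht0
      (by linarith : t ≤ t + τ) (fun r hr => by
        have h := ht (r - t) ⟨by linarith [hr.1], by linarith [hr.2]⟩
        rw [add_sub_cancel] at h
        rcases hij (u r) with hk | hk <;> rw [hk]
        exacts [h.1.le, h.2.le])
    simpa using this
  have h2 : c ≤ c + C * τ :=
    le_of_tendsto_of_tendsto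
      (hc.comp ((tendsto_atTop_add_const_right _ τ tendsto_id).mono_left hL))
      ((hc.mono_left hL).add_const _) h1
  have := mul_neg_of_neg_of_pos hC0 hτ
  linarith

/-- The limit of the Lyapunov function vanishes if it eventually decreases less along `f i` than
along `f j` and the fields are not both tangent to its level set at a limit point. -/
theorem IsForwardSolution.eq_zero_of_eventually_lt (hf : ∀ i, ContDiff ℝ ∞ (f i))
    (hV : IsWeakLyapunov f V) (hij : ∀ k, k = i ∨ k = j)
    (hφ : IsForwardSolution (fun t => f (u t)) x φ) (hφR : ∀ t, 0 ≤ t → ‖φ t‖ ≤ R)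
    (hc : Tendsto (fun t => V (φ t)) atTop (𝓝 c))
    (hflow : ∀ l ∈ omegaLimitSet φ, FlowConvergesToZero (f i) l)
    (hΩ : ∀ l ∈ omegaLimitSet φ, lieDerivative (f i) V l ≠ lieDerivative (f j) V l)
    (hlt : ∀ᶠ t in atTop, lieDerivative (f j) V (φ t) < lieDerivative (f i) V (φ t)) : c = 0 := by
  have hcont := hV.continuous_lieDerivative hf
  have hneg : ∀ l ∈ omegaLimitSet φ, lieDerivative (f j) V l < 0 := by
    intro l hl
    obtain ⟨L, hLb, hL, hLl⟩ := exists_filter_of_mem_omegaLimitSet hl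
    have h1 : lieDerivative (f j) V l ≤ lieDerivative (f i) V l :=
      le_of_tendsto_of_tendsto (((hcont j).tendsto l).comp hLl) (((hcont i).tendsto l).comp hLl)
        ((hlt.filter_mono hL).mono fun t ht => le_of_lt ht)
    exact (h1.lt_of_ne (hΩ l hl).symm).trans_le (hV.lie_nonpos i l)
  have hne := omegaLimitSet_nonempty hφR
  -- Compactness gives a bound `C < 0` valid at all late times, so the comparison below has no
  -- restriction on τ.
  obtain ⟨m, hm, hmax⟩ := (isCompact_omegaLimitSet hφR).exists_isMaxOn hne (hcont j).continuousOn
  obtain ⟨C, hCm, hC0⟩ := exists_between (hneg m hm)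
  have hev : ∀ᶠ t in atTop, φ t ∈ {y | lieDerivative (f j) V y < C} :=
    eventually_mem_of_omegaLimitSet_subset hφR (isOpen_lt (hcont j) continuous_const)
      fun l hl => (hmax hl).trans_lt hCm
  obtain ⟨L, hLb, hL, hLl⟩ := exists_filter_of_mem_omegaLimitSet hm
  obtain ⟨γ, R', hγ, hγ0, hγR⟩ := (hflow m hm).exists_bounded
  obtain ⟨T, hT⟩ := hev.exists_forall_of_atTop
  have hconst : ∀ τ, 0 ≤ τ → V (γ τ) = c := by
    intro τ hτ
    refine hφ.apply_eq_of_tendsto hf hV hij hγ (R := max R R')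
      (fun t ht => (hφR t ht).trans (le_max_left _ _))
      (fun t ht => (hγR t ht).trans (le_max_right _ _)) hc hL hLl (η := -C) (by linarith) hτ ?_
    filter_upwards [hL (eventually_ge_atTop T)] with t (ht : T ≤ t) s hs
    have : lieDerivative (f j) V (φ (t + s)) < C := hT (t + s) (by linarith [hs.1])
    linarith
  have h3 : Tendsto (fun t => V (γ t)) atTop (𝓝 0) :=
    (hV.smooth.continuous.tendsto' 0 0 hV.map_zero).comp hγ0
  refine tendsto_nhds_unique (tendsto_const_nhds.congr' ?_) h3
  filter_upwards [eventually_ge_atTop 0] with t ht using (hconst t ht).symm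

theorem IsForwardSolution.eq_zero_or_exists (hf : ∀ i, ContDiff ℝ ∞ (f i))
    (hV : IsWeakLyapunov f V) (hij : ∀ k, k = i ∨ k = j)
    (hφ : IsForwardSolution (fun t => f (u t)) x φ) (hφR : ∀ t, 0 ≤ t → ‖φ t‖ ≤ R)
    (hc : Tendsto (fun t => V (φ t)) atTop (𝓝 c))
    (hflow : ∀ l ∈ omegaLimitSet φ, ∀ k, FlowConvergesToZero (f k) l) :
    c = 0 ∨ ∃ l ∈ omegaLimitSet φ, lieDerivative (f i) V l = 0 ∧ lieDerivative (f j) V l = 0 := by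
  by_contra! h
  obtain ⟨hc0, h⟩ := h
  have hcont := hV.continuous_lieDerivative hf
  -- One of the two derivatives vanishes, so equality would make both vanish.
  have hΩ : ∀ l ∈ omegaLimitSet φ, lieDerivative (f i) V l ≠ lieDerivative (f j) V l := by
    intro l hl heq
    have h1 := hφ.lieDerivative_eq_zero_or hf hV hij hφR hc hl
    rw [heq, or_self] at h1
    exact h l hl (heq.trans h1) h1
  have hev : ∀ᶠ t in atTop, φ t ∈ {y | lieDerivative (f i) V y ≠ lieDerivative (f j) V y} :=
    eventually_mem_of_omegaLimitSet_subset hφR (isOpen_ne_fun (hcont i) (hcont j)) hΩ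
  obtain ⟨T, hT⟩ := (hev.and (eventually_ge_atTop 0)).exists_forall_of_atTop
  have hT0 : 0 ≤ T := (hT T le_rfl).2
  set D : ℝ → ℝ := fun t => lieDerivative (f i) V (φ t) - lieDerivative (f j) V (φ t) with hD
  have hDc : ContinuousOn D (Ici T) :=
    (((hcont i).sub (hcont j)).comp_continuousOn hφ.2.1).mono (Ici_subset_Ici.2 hT0)
  have hD0 : ∀ t ∈ Ici T, D t ≠ 0 := fun t ht => sub_ne_zero.2 (hT t ht).1
  have hsign : (∀ t ∈ Ici T, 0 < D t) ∨ ∀ t ∈ Ici T, D t < 0 := by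
    by_contra! h
    obtain ⟨⟨s, hs, hDs⟩, t, ht, hDt⟩ := h
    obtain ⟨r, hr, hDr⟩ := isPreconnected_Ici.intermediate_value hs ht hDc ⟨hDs, hDt⟩
    exact hD0 r hr hDr
  rcases hsign with h | h
  · refine hc0 (hφ.eq_zero_of_eventually_lt hf hV hij hφR hc (fun l hl => hflow l hl i) hΩ ?_)
    filter_upwards [eventually_ge_atTop T] with t ht using sub_pos.1 (h t ht)
  · refine hc0 (hφ.eq_zero_of_eventually_lt hf hV (fun k => (hij k).symm) hφR hc
      (fun l hl => hflow l hl j) (fun l hl => (hΩ l hl).symm) ?_)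
    filter_upwards [eventually_ge_atTop T] with t ht using sub_neg.1 (h t ht)

/-- The strict decrease along `f j` is known only near `l`, so the comparison lasts for a short
time; analyticity extends the constancy of `V` to the whole flow line of `f i`. -/
theorem IsForwardSolution.eq_zero_or_lieDerivative_eq_zero (hf : ∀ i, ContDiff ℝ ∞ (f i))
    (hV : IsWeakLyapunov f V) (hij : ∀ k, k = i ∨ k = j)
    (hφ : IsForwardSolution (fun t => f (u t)) x φ) (hφR : ∀ t, 0 ≤ t → ‖φ t‖ ≤ R)
    (hc : Tendsto (fun t => V (φ t)) atTop (𝓝 c))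
    (hfa : AnalyticOnNhd ℝ (f i) univ) (hVa : AnalyticOnNhd ℝ V univ)
    {l : StateSpace d} (hl : l ∈ omegaLimitSet φ) (hflow : FlowConvergesToZero (f i) l) :
    c = 0 ∨ lieDerivative (f j) V l = 0 := by
  by_contra! hne
  obtain ⟨C, hCl, hC0⟩ := exists_between ((hV.lie_nonpos j l).lt_of_ne hne.2)
  obtain ⟨L, hLb, hL, hLl⟩ := exists_filter_of_mem_omegaLimitSet hl
  have hO : {y | lieDerivative (f j) V y < C} ∈ 𝓝 l :=
    (hV.continuous_lieDerivative hf j).continuousAt.eventually_lt_const hCl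
  obtain ⟨τ, hτ, hτL⟩ := hφ.exists_forall_mem_of_tendsto (fun k => (hf k).continuous) hφR hL hLl hO
  obtain ⟨γ, R', hγ, hγ0, hγR⟩ := hflow.exists_bounded
  refine hne.1 ((hγ.eq_of_tendsto_zero hfa hVa hγ0 hτ fun s hs => ?_).trans hV.map_zero)
  refine hφ.apply_eq_of_tendsto hf hV hij hγ (R := max R R')
    (fun t ht => (hφR t ht).trans (le_max_left _ _))
    (fun t ht => (hγR t ht).trans (le_max_right _ _)) hc hL hLl (η := -C) (by linarith) hs.1 ?_
  filter_upwards [hτL] with t ht r hr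
  have : lieDerivative (f j) V (φ (t + r)) < C := ht r ⟨hr.1, hr.2.trans hs.2⟩
  linarith

theorem IsWeakLyapunov.eq_zero_of_mem_omegaLimitSet {ι : Type*}
    {f : ι → StateSpace d → StateSpace d} (hV : IsWeakLyapunov f V)
    (hc : Tendsto (fun t => V (φ t)) atTop (𝓝 0)) {l : StateSpace d} (hl : l ∈ omegaLimitSet φ) :
    l = 0 := by
  obtain ⟨L, hLb, hL, hLl⟩ := exists_filter_of_mem_omegaLimitSet hl
  by_contra h
  exact (hV.pos l h).ne'
    (tendsto_nhds_unique ((hV.smooth.continuous.tendsto l).comp hLl) (hc.mono_left hL))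

end Main

theorem mainTheorem7 (d : ℕ) (f : Fin 2 → StateSpace d → StateSpace d) (V : StateSpace d → ℝ)
    (hf : ∀ i, ContDiff ℝ ∞ (f i)) (hf0 : ∀ i, f i 0 = 0)
    (hV : IsWeakLyapunov f V)
    (hstable : ∀ i, IsAsymptoticallyStable (f i)) :
    (∃ W : Set (StateSpace d), IsAdmissibleNhd f W) ∧
    (∀ W : Set (StateSpace d), IsAdmissibleNhd f W →
      ∀ x ∈ W, ∀ u : ℝ → Fin 2, IsInput u →
        ∀ φ : ℝ → StateSpace d, IsForwardSolution (fun t => f (u t)) x φ →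
          (omegaLimitSet φ ∩ (tangencySet (f 0) V ∩ tangencySet (f 1) V)).Nonempty ∧
          ((∀ i, AnalyticOnNhd ℝ (f i) univ) → AnalyticOnNhd ℝ V univ →
            omegaLimitSet φ ⊆ tangencySet (f 0) V ∩ tangencySet (f 1) V)) ∧
    ((∀ i, IsGloballyAsymptoticallyStable (f i)) →
      Tendsto V (cocompact (StateSpace d)) atTop →
        IsAdmissibleNhd f univ) := by

  refine ⟨exists_isAdmissibleNhd hf hV hstable, ?_, fun h hVt => isAdmissibleNhd_univ hf hV h hVt⟩
  intro W hW x hx u hu φ hφ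
  obtain ⟨ψ, hψ, hψb, hψW⟩ := hW.forward x hx u hu
  -- Admissibility only provides some bounded solution in `W`; uniqueness transfers its properties
  -- to `φ`.
  have hφψ := hφ.eqOn hf hψ
  obtain ⟨R, hR⟩ := hψb.exists_norm_le
  have hφR : ∀ t, 0 ≤ t → ‖φ t‖ ≤ R := fun t ht => by
    rw [hφψ ht]
    exact hR _ ⟨t, ht, rfl⟩
  have hflow : ∀ l ∈ omegaLimitSet φ, ∀ k, FlowConvergesToZero (f k) l := by
    rintro l ⟨t, -, ht0, -, hl⟩ k
    refine hW.attracted l (hW.isClosed.mem_of_tendsto hl (Eventually.of_forall fun n => ?_)) k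
    rw [hφψ (ht0 n)]
    exact hψW _ (ht0 n)
  obtain ⟨c, hc⟩ := hφ.exists_tendsto hV
  have hij : ∀ k : Fin 2, k = 0 ∨ k = 1 := by simp [Fin.forall_fin_two]
  have h0 : ∀ k, (0 : StateSpace d) ∈ tangencySet (f k) V := fun k => by
    simp [tangencySet, lieDerivative, hf0 k]
  have hzero : c = 0 → omegaLimitSet φ ⊆ tangencySet (f 0) V ∩ tangencySet (f 1) V := by
    rintro rfl l hl
    rw [hV.eq_zero_of_mem_omegaLimitSet hc hl]
    exact ⟨h0 0, h0 1⟩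
  refine ⟨?_, fun hfa hVa l hl => ?_⟩
  · rcases hφ.eq_zero_or_exists hf hV hij hφR hc hflow with h | ⟨l, hl, hl0, hl1⟩
    · obtain ⟨l, hl⟩ := omegaLimitSet_nonempty hφR
      exact ⟨l, hl, hzero h hl⟩
    · exact ⟨l, hl, hl0, hl1⟩
  · rcases hφ.eq_zero_or_lieDerivative_eq_zero hf hV (fun k => (hij k).symm) hφR hc (hfa 1) hVa hl
      (hflow l hl 1) with h | h
    · exact hzero h hl
    rcases hφ.eq_zero_or_lieDerivative_eq_zero hf hV hij hφR hc (hfa 0) hVa hl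
      (hflow l hl 0) with h' | h'
    · exact hzero h' hl
    exact ⟨h, h'⟩
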